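/- Let $n\in\{1,2,\dots\}\cup\{\infty\}$ and let $D\subset\mathbb R^2$ be a bounded domain with boundary of class $C^{n+1}$ (so at least $C^2$) and with connected exterior $\mathbb R^2\setminus\overline D$. Let $\nu_x$ be the outward unit normal at $x\in\partial D$ and let $ds$ be arc length. For $k>0$ let $G^k(z)=-\frac{\mathrm i}{4}H^1_0(k|z|)$, where $H^1_0$ is the Hankel function of the first kind of order zero, and let $$(K^k_{\partial D})^*[\varphi](x)=\int_{\partial D}\partial_{\nu_x}G^k(x-y)\,\varphi(y)\,ds(y),\qquad x\in\partial D,$$ be the Helmholtz Neumann–Poincaré operator on $L^2(\partial D)$ (complex-valued functions). Let $x_R\in\partial D$ be any boundary point (for instance, a point of maximal curvature). For $\rho>0$ put $\Gamma_1=\partial D\cap B_\rho(x_R)$ and $\Gamma_2=\partial D\setminus\Gamma_1$, and let $$K^*_{\Gamma_1}[\varphi](x)=\frac1{2\pi}\int_{\Gamma_1}\frac{\langle x-y,\nu_x\rangle}{|x-y|^2}\,\varphi(y)\,ds(y),\qquad x\in\Gamma_1.$$ Then there are constants $C,\rho_0,\varepsilon>0$, which do not depend on $\rho$ and $k$, such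 that for all $0<\rho<\rho_0$ and all $k>0$ the operators $(K^k_{\partial D})^*$ and $K^*_{\Gamma_1}$ are bounded on $L^2(\partial D)$ and on $L^2(\Gamma_1)$ respectively, and there are bounded operators $\mathcal R_{\Gamma_1,\rho}:L^2(\Gamma_1)\to L^2(\Gamma_1)$ and $\mathcal T:L^2(\Gamma_2)\to L^2(\Gamma_1)$ with $$(K^k_{\partial D})^*[\varphi]\big|_{\Gamma_1}=K^*_{\Gamma_1}[\varphi|_{\Gamma_1}]+\mathcal R_{\Gamma_1,\rho}[\varphi|_{\Gamma_1}]+\mathcal T[\varphi|_{\Gamma_2}]\qquad\text{for all }\varphi\in L^2(\partial D).$$ Here $\mathcal T$ is smoothing, to the order that the regularity of $\partial D$ allows: it is an integral operator whose kernel is of class $C^n$ on $\Gamma_1\times\Gamma_2$, and it maps $L^2(\Gamma_2)$ into $C^n(\Gamma_1)$ (so into $C^\infty(\Gamma_1)$ if $\partial D$ is of class $C^\infty$); a function is of class $C^n$ on a set if near every point of the set it is the restriction of a $C^n$ function on an open set. Moreover, $$\|\mathcal R_{\Gamma_1,\rho}\|_{L^2(\Gamma_1)\to L^2(\Gamma_1)}\le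 C\,(\rho k)^2\,|\ln(\rho k)|\qquad\text{whenever }\rho k<\varepsilon.$$ -/

import Mathlib

open MeasureTheory Set
open scoped MeasureTheory ENNReal NNReal ContDiff InnerProductSpace

noncomputable section

namespace NPOperator

/-- The Euclidean plane. -/
abbrev Plane : Type := EuclideanSpace ℝ (Fin 2)

/-! ### Planar domains with boundary of class `C^m` -/

/-- `h` is a local defining function of class `C^m` of `D` on the open set `U`: the differential of
`h` vanishes nowhere on `U`, and `D` is `{h < 0}` inside `U`. In particular
`frontier D` is `{h = 0}` inside `U`. -/
structure IsDefiningFunction (m : ℕ∞) (D U : Set Plane) (h : Plane → ℝ) : Prop where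
  isOpen : IsOpen U
  contDiffOn : ContDiffOn ℝ m h U
  gradient_ne_zero : ∀ y ∈ U, gradient h y ≠ 0
  inter_eq : D ∩ U = {y ∈ U | h y < 0}

/-- A bounded domain of the plane with boundary of class `C^m` and with a connected exterior. -/
structure IsSmoothDomain (m : ℕ∞) (D : Set Plane) : Prop where
  isOpen : IsOpen D
  isConnected : IsConnected D
  isBounded : Bornology.IsBounded D
  isConnected_exterior : IsConnected (closure D)ᶜ
  exists_definingFunction : ∀ x ∈ frontier D, ∃ U h, x ∈ U ∧ IsDefiningFunction m D U h

/-- `n` is the outward unit normal to `frontier D` at `x`. -/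
def IsOutwardUnitNormal (D : Set Plane) (x n : Plane) : Prop :=
  ∃ U h, x ∈ U ∧ h x = 0 ∧ IsDefiningFunction 1 D U h ∧ n = ‖gradient h x‖⁻¹ • gradient h x

open Classical in
/-- The outward unit normal vector `ν_x` to `frontier D` at `x` (and `0` where there is none). -/
def outwardNormal (D : Set Plane) (x : Plane) : Plane :=
  if hn : ∃ n, IsOutwardUnitNormal D x n then hn.choose else 0

/-- The arc length measure `ds` on `frontier D`, that is, the one-dimensional Hausdorff measure. -/
def arcLength (D : Set Plane) : Measure Plane :=
  (μH[1] : Measure Plane).restrict (frontier D)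

/-- The complex space `L²(Γ)`, with respect to arc length, of a part `Γ` of `frontier D`. -/
abbrev L2 (D Γ : Set Plane) : Type := Lp ℂ 2 ((arcLength D).restrict Γ)

/-! ### Fundamental solutions -/

/-- The Bessel function `J₀` of the first kind. -/
def besselJ0 (t : ℝ) : ℝ :=
  ∑' j : ℕ, (-1) ^ j * (t / 2) ^ (2 * j) / (j.factorial : ℝ) ^ 2

/-- The Bessel function `Y₀` of the second kind, for `t > 0`. -/
def besselY0 (t : ℝ) : ℝ :=
  2 / Real.pi * ((Real.log (t / 2) + Real.eulerMascheroniConstant) * besselJ0 t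
    - ∑' j : ℕ, (-1) ^ j * (harmonic j : ℝ) * (t / 2) ^ (2 * j) / (j.factorial : ℝ) ^ 2)

/-- The Hankel function `H₀¹ = J₀ + i Y₀` of the first kind, for `t > 0`. -/
def hankel0 (t : ℝ) : ℂ := besselJ0 t + Complex.I * besselY0 t

/-- The outgoing fundamental solution `Gᵏ(z) = -(i/4) H₀¹(k|z|)` of the Helmholtz operator. -/
def helmholtzG (k : ℝ) (z : Plane) : ℂ := -(Complex.I / 4) * hankel0 (k * ‖z‖)

/-- The kernel `∂_{ν_x} Gᵏ(x - y)` of the Helmholtz Neumann–Poincaré operator. -/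
def helmholtzKernel (D : Set Plane) (k : ℝ) (x y : Plane) : ℂ :=
  fderiv ℝ (helmholtzG k) (x - y) (outwardNormal D x)

/-- The kernel `⟨x - y, ν_x⟩ / (2π |x - y|²)` of the electrostatic Neumann–Poincaré operator. -/
def laplaceKernel (D : Set Plane) (x y : Plane) : ℂ :=
  ((1 / (2 * Real.pi) * (⟪x - y, outwardNormal D x⟫_ℝ / ‖x - y‖ ^ 2) : ℝ) : ℂ)

/-! ### Integral operators -/

/-- `A : L²(μ) → L²(μ')` is the integral operator `A φ (x) = ∫ κ(x, y) φ(y) dμ(y)`, where the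
integral converges absolutely for almost every `x`. -/
def IsIntegralOperator (κ : Plane → Plane → ℂ) {μ μ' : Measure Plane}
    (A : Lp ℂ 2 μ →L[ℂ] Lp ℂ 2 μ') : Prop :=
  ∀ φ : Lp ℂ 2 μ, ∀ᵐ x ∂μ',
    Integrable (fun y => κ x y * φ y) μ ∧ A φ x = ∫ y, κ x y * φ y ∂μ

/-- `f` is of class `C^n` on the subset `S` of a normed space: near every point of `S` it is the
restriction to `S` of a `C^n` function on an open set. -/
def IsSmoothOn {X : Type*} [NormedAddCommGroup X] [NormedSpace ℝ X] (n : ℕ∞) (f : X → ℂ)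
    (S : Set X) : Prop :=
  ∀ x ∈ S, ∃ (U : Set X) (F : X → ℂ), IsOpen U ∧ x ∈ U ∧ ContDiffOn ℝ n F U ∧ EqOn F f (U ∩ S)

/-- The bounded operator `T : L²(Γ') → L²(Γ)` is smoothing of class `C^n`: it is the integral
operator of a kernel which is of class `C^n` on `Γ × Γ'`, and it maps `L²(Γ')` into the functions
of class `C^n` on `Γ`. -/
structure IsSmoothing (n : ℕ∞) {D Γ' Γ : Set Plane} (T : L2 D Γ' →L[ℂ] L2 D Γ) : Prop where
  exists_kernel : ∃ t : Plane → Plane → ℂ,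
    IsSmoothOn n (fun p : Plane × Plane => t p.1 p.2) (Γ ×ˢ Γ') ∧ IsIntegralOperator t T
  range_smooth : ∀ φ : L2 D Γ', ∃ f : Plane → ℂ,
    IsSmoothOn n f Γ ∧ T φ =ᵐ[(arcLength D).restrict Γ] f

/-- The restriction map `φ ↦ φ|_Γ` from `L²(∂D)` to `L²(Γ)`. -/
def restrictTo (D Γ : Set Plane) : Lp ℂ 2 (arcLength D) →L[ℂ] L2 D Γ :=
  LpToLpRestrictCLM Plane ℂ ℂ (arcLength D) 2 Γ

/-- The boundary piece `Γ₁ = ∂D ∩ B_ρ(x₀)`. -/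
def nearPart (D : Set Plane) (x₀ : Plane) (ρ : ℝ) : Set Plane := frontier D ∩ Metric.ball x₀ ρ

/-- The remaining part `Γ₂ = ∂D \ Γ₁` of the boundary. -/
def farPart (D : Set Plane) (x₀ : Plane) (ρ : ℝ) : Set Plane := frontier D \ nearPart D x₀ ρ

end NPOperator

end

namespace NPOperator

/-! ### The singularity of the fundamental solution -/

/-! The power series of `J₀` and `Y₀` give `-(i/4) H₀¹(t) = P(s) + Q(s) log s` with `s = (t/2)²`,
`P` and `Q` smooth, `Q 0 = 1/(4π)` (`exists_hankel0_eq`). In the normal derivative, the term `Q 0 /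
s` produces exactly the electrostatic kernel, and what remains is `k²/2 ⟨x - y, ν_x⟩` times `O(1 +
|log s|)` (`helmholtz_sub_laplace`). So `R` is the operator on `Γ₁` whose kernel is the difference.
For points of `Γ₁` one has `t/2 ≤ ρk`, hence this kernel is `O(k · ρk |log ρk|)`. The length of `Γ₁`
is at most `4ρ` (`exists_hausdorffMeasure_le`), and the operator norm is at most supremum times
length, which gives `(ρk)² |log ρk|`.

Curvature enters only through the boundedness of the electrostatic kernel
(`exists_inner_normal_le`), which needs a `C²` boundary. The operator `T` is the Helmholtz kernel on
`Γ₁ × Γ₂`, where `x ≠ y`; its smoothness in `x` is limited only by that of the normal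
(`IsSmoothDomain.isSmoothing`). -/

theorem contDiff_tsum_mul_pow {a : ℕ → ℝ} (ha : ∀ j, |a j| ≤ 1 / (j.factorial : ℝ)) :
    ContDiff ℝ ∞ fun s : ℝ => ∑' j : ℕ, a j * s ^ j := by
  let p : FormalMultilinearSeries ℝ ℝ ℝ := FormalMultilinearSeries.ofScalars ℝ a
  have hr : p.radius = ⊤ := by
    apply FormalMultilinearSeries.radius_eq_top_of_summable_norm
    intro r
    refine Summable.of_nonneg_of_le (fun j => by positivity) (fun j => ?_)
      (Real.summable_pow_div_factorial (r : ℝ))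
    rw [FormalMultilinearSeries.ofScalars_norm, Real.norm_eq_abs, div_eq_mul_one_div, mul_comm]
    gcongr
    exact ha j
  have hp : AnalyticOnNhd ℝ p.sum univ := by
    have h := p.hasFPowerSeriesOnBall (hr ▸ ENNReal.zero_lt_top)
    have := h.analyticOnNhd
    rwa [hr, Metric.eball_top] at this
  have hs : p.sum = fun s : ℝ => ∑' j : ℕ, a j * s ^ j := by
    funext s
    exact FormalMultilinearSeries.ofScalars_sum_eq a s
  rw [← hs]
  exact contDiffOn_univ.1 (hp.contDiffOn uniqueDiffOn_univ)

theorem abs_besselCoeff_le (j : ℕ) :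
    |(-1 : ℝ) ^ j / (j.factorial : ℝ) ^ 2| ≤ 1 / (j.factorial : ℝ) := by
  have h1 : (1 : ℝ) ≤ j.factorial := by exact_mod_cast j.factorial_pos
  rw [abs_div, abs_pow, abs_neg, abs_one, one_pow, abs_of_nonneg (by positivity)]
  gcongr
  nlinarith

/-- A crude bound suffices: it uses up one of the two factorials in the series of `Y₀` and leaves
the other for convergence. -/
theorem harmonic_le_factorial (j : ℕ) : (harmonic j : ℝ) ≤ j.factorial := by
  have h : (harmonic j : ℝ) ≤ j := by
    induction j with
    | zero => simp
    | succ j ih =>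
      rw [harmonic_succ]
      push_cast
      have : ((j : ℝ) + 1)⁻¹ ≤ 1 := inv_le_one_of_one_le₀ (by linarith [Nat.cast_nonneg (α := ℝ) j])
      linarith
  exact h.trans (by exact_mod_cast j.self_le_factorial)

theorem abs_harmonicBesselCoeff_le (j : ℕ) :
    |(-1 : ℝ) ^ j * harmonic j / (j.factorial : ℝ) ^ 2| ≤ 1 / (j.factorial : ℝ) := by
  have h1 : (1 : ℝ) ≤ j.factorial := by exact_mod_cast j.factorial_pos
  have h0 : (0 : ℝ) ≤ harmonic j := by
    unfold harmonic
    push_cast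
    exact Finset.sum_nonneg fun i _ => by positivity
  rw [abs_div, abs_mul, abs_pow, abs_neg, abs_one, one_pow, one_mul, abs_of_nonneg h0,
    abs_of_nonneg (by positivity), div_le_div_iff₀ (by positivity) (by positivity)]
  nlinarith [harmonic_le_factorial j]

/-- `-(i/4) H₀¹(t) = P(s) + Q(s) log s` with `s = (t/2)²` and smooth `P`, `Q`. -/
theorem exists_hankel0_eq : ∃ P Q : ℝ → ℂ, ContDiff ℝ ∞ P ∧ ContDiff ℝ ∞ Q ∧
    Q 0 = ((1 / (4 * Real.pi) : ℝ) : ℂ) ∧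
    ∀ t : ℝ, 0 < t → -(Complex.I / 4) * hankel0 t =
      P ((t / 2) ^ 2) + Q ((t / 2) ^ 2) * (Real.log ((t / 2) ^ 2) : ℝ) := by
  set B : ℝ → ℝ := fun s => ∑' j : ℕ, (-1 : ℝ) ^ j / (j.factorial : ℝ) ^ 2 * s ^ j with hB
  set S : ℝ → ℝ := fun s => ∑' j : ℕ, (-1 : ℝ) ^ j * harmonic j / (j.factorial : ℝ) ^ 2 * s ^ j
    with hS
  have cB : ContDiff ℝ ∞ B := contDiff_tsum_mul_pow abs_besselCoeff_le
  have cS : ContDiff ℝ ∞ S := contDiff_tsum_mul_pow abs_harmonicBesselCoeff_le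
  have hB0 : B 0 = 1 := by
    simp only [hB]
    rw [tsum_eq_single 0 (fun j hj => by simp [hj])]
    simp
  have hJ : ∀ t, besselJ0 t = B ((t / 2) ^ 2) := fun t => by
    simp only [besselJ0, hB]
    refine tsum_congr fun j => ?_
    rw [pow_mul]; ring
  have hY : ∀ t, ∑' j : ℕ, (-1) ^ j * (harmonic j : ℝ) * (t / 2) ^ (2 * j) /
      (j.factorial : ℝ) ^ 2 = S ((t / 2) ^ 2) := fun t => by
    simp only [hS]
    refine tsum_congr fun j => ?_
    rw [pow_mul]; ring
  have ofR : ∀ f : ℝ → ℝ, ContDiff ℝ ∞ f → ContDiff ℝ ∞ fun s => (f s : ℂ) := fun f hf =>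
    Complex.ofRealCLM.contDiff.comp hf
  -- Since `log (t/2) = (log s)/2`, the factor `1/(2π)` of the logarithm in `Y₀/4` becomes `1/(4π)`
  -- in `Q`.
  refine ⟨fun s => (((Real.eulerMascheroniConstant * B s - S s) / (2 * Real.pi) : ℝ) : ℂ)
      - Complex.I / 4 * (B s : ℂ), fun s => ((B s / (4 * Real.pi) : ℝ) : ℂ), ?_, ?_, ?_, ?_⟩
  · exact (ofR _ (((contDiff_const.mul cB).sub cS).div_const _)).sub
      (contDiff_const.mul (ofR _ cB))
  · exact ofR _ (cB.div_const _)
  · simp [hB0]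
  · intro t ht
    have hl : Real.log ((t / 2) ^ 2) = 2 * Real.log (t / 2) := by rw [Real.log_pow]; norm_num
    simp only [hankel0, besselY0, hJ, hY, hl]
    have hpi : (Real.pi : ℂ) ≠ 0 := by exact_mod_cast Real.pi_ne_zero
    push_cast
    field_simp
    ring_nf
    simp only [Complex.I_sq]
    ring

variable {P Q : ℝ → ℂ}

/-- The regular part of the derivative of `P + Q log`. -/
noncomputable def regularPart (P Q : ℝ → ℂ) (s : ℝ) : ℂ :=
  deriv P s + deriv Q s * (Real.log s : ℝ) + (Q s - Q 0) / s

/-- Writing `Q s / s` as `Q 0 / s + (Q s - Q 0) / s` isolates the only singularity worse than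
logarithmic. -/
theorem hasDerivAt_add_mul_log (hP : ContDiff ℝ ∞ P) (hQ : ContDiff ℝ ∞ Q) {s : ℝ} (hs : 0 < s) :
    HasDerivAt (fun s => P s + Q s * (Real.log s : ℝ)) (regularPart P Q s + Q 0 / s) s := by
  have h1 := (hP.differentiable (by simp) s).hasDerivAt
  have h2 := (hQ.differentiable (by simp) s).hasDerivAt
  have h3 := (Real.hasDerivAt_log hs.ne').ofReal_comp
  refine (h1.add (h2.mul h3)).congr_deriv ?_
  have : (s : ℂ) ≠ 0 := by exact_mod_cast hs.ne'
  rw [regularPart]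
  push_cast
  field_simp
  ring

/-- The mean value inequality bounds the difference quotient of `Q`, so only the logarithm is
unbounded near `0`. -/
theorem exists_norm_regularPart_le (hP : ContDiff ℝ ∞ P) (hQ : ContDiff ℝ ∞ Q) (S : ℝ) :
    ∃ C, 0 ≤ C ∧ ∀ s, 0 < s → s ≤ S → ‖regularPart P Q s‖ ≤ C * (1 + |Real.log s|) := by
  obtain ⟨a, ha⟩ := isCompact_Icc.exists_bound_of_continuousOn (s := Icc 0 S)
    (hP.continuous_deriv (by simp)).continuousOn
  obtain ⟨b, hb⟩ := isCompact_Icc.exists_bound_of_continuousOn (s := Icc 0 S)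
    (hQ.continuous_deriv (by simp)).continuousOn
  refine ⟨|a| + |b|, by positivity, fun s hs hsS => ?_⟩
  have hm : s ∈ Icc 0 S := ⟨hs.le, hsS⟩
  have h3 : ‖(Q s - Q 0) / s‖ ≤ |b| := by
    have := (convex_Icc 0 S).norm_image_sub_le_of_norm_deriv_le
      (fun x _ => hQ.differentiable (by simp) x) hb (x := 0) (y := s)
      ⟨le_rfl, hs.le.trans hsS⟩ hm
    rw [sub_zero, Real.norm_eq_abs, abs_of_pos hs] at this
    rw [norm_div, Complex.norm_real, Real.norm_eq_abs, abs_of_pos hs, div_le_iff₀ hs]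
    exact this.trans (mul_le_mul_of_nonneg_right (le_abs_self b) hs.le)
  have h2 : ‖deriv Q s * (Real.log s : ℝ)‖ ≤ |b| * |Real.log s| := by
    rw [norm_mul, Complex.norm_real, Real.norm_eq_abs]
    gcongr
    exact (hb s hm).trans (le_abs_self b)
  have h1 : ‖deriv P s‖ ≤ |a| := (ha s hm).trans (le_abs_self a)
  calc ‖regularPart P Q s‖ ≤ |a| + |b| * |Real.log s| + |b| := by
        refine (norm_add_le _ _).trans (add_le_add ((norm_add_le _ _).trans ?_) h3)
        exact add_le_add h1 h2
    _ ≤ _ := by nlinarith [abs_nonneg a, abs_nonneg (Real.log s)]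

theorem helmholtzG_eq (hG : ∀ t : ℝ, 0 < t → -(Complex.I / 4) * hankel0 t =
      P ((t / 2) ^ 2) + Q ((t / 2) ^ 2) * (Real.log ((t / 2) ^ 2) : ℝ))
    {k : ℝ} (hk : 0 < k) {z : Plane} (hz : z ≠ 0) :
    helmholtzG k z = P (k ^ 2 / 4 * ‖z‖ ^ 2) +
      Q (k ^ 2 / 4 * ‖z‖ ^ 2) * (Real.log (k ^ 2 / 4 * ‖z‖ ^ 2) : ℝ) := by
  have : k ^ 2 / 4 * ‖z‖ ^ 2 = (k * ‖z‖ / 2) ^ 2 := by ring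
  rw [this]
  exact hG _ (mul_pos hk (norm_pos_iff.2 hz))

theorem contDiffAt_helmholtzG {k : ℝ} (hk : 0 < k) {z : Plane} (hz : z ≠ 0) :
    ContDiffAt ℝ ∞ (helmholtzG k) z := by
  obtain ⟨P, Q, hP, hQ, -, hG⟩ := exists_hankel0_eq
  have hs : ContDiff ℝ ∞ fun z : Plane => k ^ 2 / 4 * ‖z‖ ^ 2 :=
    contDiff_const.mul (contDiff_norm_sq ℝ)
  have hne : k ^ 2 / 4 * ‖z‖ ^ 2 ≠ 0 := by
    have := norm_pos_iff.2 hz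
    positivity
  have h : ContDiffAt ℝ ∞ (fun z : Plane => P (k ^ 2 / 4 * ‖z‖ ^ 2) +
      Q (k ^ 2 / 4 * ‖z‖ ^ 2) * (Real.log (k ^ 2 / 4 * ‖z‖ ^ 2) : ℝ)) z :=
    (hP.comp hs).contDiffAt.add ((hQ.comp hs).contDiffAt.mul
      (Complex.ofRealCLM.contDiff.contDiffAt.comp z (hs.contDiffAt.log hne)))
  refine h.congr_of_eventuallyEq ?_
  filter_upwards [isOpen_ne.mem_nhds hz] with w hw using helmholtzG_eq hG hk hw

theorem fderiv_helmholtzG_apply (hP : ContDiff ℝ ∞ P) (hQ : ContDiff ℝ ∞ Q)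
    (hG : ∀ t : ℝ, 0 < t → -(Complex.I / 4) * hankel0 t =
      P ((t / 2) ^ 2) + Q ((t / 2) ^ 2) * (Real.log ((t / 2) ^ 2) : ℝ))
    {k : ℝ} (hk : 0 < k) {z : Plane} (hz : z ≠ 0) (v : Plane) :
    fderiv ℝ (helmholtzG k) z v =
      (regularPart P Q (k ^ 2 / 4 * ‖z‖ ^ 2) + Q 0 / (k ^ 2 / 4 * ‖z‖ ^ 2 : ℝ)) *
        ((k ^ 2 / 2 * ⟪z, v⟫_ℝ : ℝ) : ℂ) := by
  have hpos : 0 < k ^ 2 / 4 * ‖z‖ ^ 2 := by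
    have := norm_pos_iff.2 hz
    positivity
  have h1 := hasDerivAt_add_mul_log hP hQ hpos
  have h2 : HasFDerivAt (fun z : Plane => k ^ 2 / 4 * ‖z‖ ^ 2)
      ((k ^ 2 / 4) • (2 • innerSL ℝ z)) z :=
    (hasStrictFDerivAt_norm_sq z).hasFDerivAt.const_mul _
  have h3 := h1.hasFDerivAt.comp z h2
  have h4 : HasFDerivAt (helmholtzG k) _ z := h3.congr_of_eventuallyEq (by
    filter_upwards [isOpen_ne.mem_nhds hz] with w hw using helmholtzG_eq hG hk hw)
  rw [h4.fderiv]
  simp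
  ring

/-- With `s = k²|x - y|²/4` the wave number cancels in `(Q 0 / s) · k²/2`, leaving `1/(2π|x - y|²)`.
-/
theorem helmholtz_sub_laplace (hP : ContDiff ℝ ∞ P) (hQ : ContDiff ℝ ∞ Q)
    (hQ0 : Q 0 = ((1 / (4 * Real.pi) : ℝ) : ℂ))
    (hG : ∀ t : ℝ, 0 < t → -(Complex.I / 4) * hankel0 t =
      P ((t / 2) ^ 2) + Q ((t / 2) ^ 2) * (Real.log ((t / 2) ^ 2) : ℝ))
    {k : ℝ} (hk : 0 < k) (D : Set Plane) {x y : Plane} (hxy : x ≠ y) :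
    helmholtzKernel D k x y - laplaceKernel D x y =
      regularPart P Q ((k * ‖x - y‖ / 2) ^ 2) *
        ((k ^ 2 / 2 * ⟪x - y, outwardNormal D x⟫_ℝ : ℝ) : ℂ) := by
  have hz := sub_ne_zero.2 hxy
  have hz' : ((‖x - y‖ : ℝ) : ℂ) ≠ 0 := by exact_mod_cast norm_ne_zero_iff.2 hz
  have hk' : (k : ℂ) ≠ 0 := by exact_mod_cast hk.ne'
  have hpi : (Real.pi : ℂ) ≠ 0 := by exact_mod_cast Real.pi_ne_zero
  have : k ^ 2 / 4 * ‖x - y‖ ^ 2 = (k * ‖x - y‖ / 2) ^ 2 := by ring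
  rw [helmholtzKernel, fderiv_helmholtzG_apply hP hQ hG hk hz, laplaceKernel, this, hQ0]
  push_cast
  field_simp
  ring

/-- The Helmholtz kernel differs from the electrostatic one by `O(k t (1 + |log t|))`,
`t = k|x - y|/2`. -/
theorem exists_norm_helmholtz_sub_laplace_le (T : ℝ) : ∃ C, 0 ≤ C ∧
    ∀ (D : Set Plane) (k : ℝ) (x y : Plane), 0 < k → x ≠ y → k * ‖x - y‖ / 2 ≤ T →
      ‖outwardNormal D x‖ ≤ 1 →
      ‖helmholtzKernel D k x y - laplaceKernel D x y‖ ≤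
        C * k * ((k * ‖x - y‖ / 2) * (1 + |Real.log (k * ‖x - y‖ / 2)|)) := by
  obtain ⟨P, Q, hP, hQ, hQ0, hG⟩ := exists_hankel0_eq
  obtain ⟨C, hC, h⟩ := exists_norm_regularPart_le hP hQ (T ^ 2)
  refine ⟨2 * C, by positivity, fun D k x y hk hxy hT hn => ?_⟩
  have hz : 0 < ‖x - y‖ := norm_pos_iff.2 (sub_ne_zero.2 hxy)
  set t := k * ‖x - y‖ / 2 with ht
  have htpos : 0 < t := by positivity
  have h1 := h (t ^ 2) (by positivity) (by gcongr)
  have hl : |Real.log (t ^ 2)| = 2 * |Real.log t| := by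
    rw [Real.log_pow, abs_mul]; norm_num
  rw [hl] at h1
  -- Cauchy–Schwarz is enough here; the quadratic bound from the curvature is not needed.
  have h2 : |⟪x - y, outwardNormal D x⟫_ℝ| ≤ ‖x - y‖ :=
    (abs_real_inner_le_norm _ _).trans (mul_le_of_le_one_right hz.le hn)
  rw [helmholtz_sub_laplace hP hQ hQ0 hG hk D hxy, norm_mul, Complex.norm_real, Real.norm_eq_abs,
    abs_mul, abs_of_pos (by positivity : 0 < k ^ 2 / 2)]
  calc ‖regularPart P Q (t ^ 2)‖ * (k ^ 2 / 2 * |⟪x - y, outwardNormal D x⟫_ℝ|)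
      ≤ (C * (1 + 2 * |Real.log t|)) * (k ^ 2 / 2 * ‖x - y‖) := by gcongr
    _ ≤ (C * (2 * (1 + |Real.log t|))) * (k ^ 2 / 2 * ‖x - y‖) := by
        gcongr; linarith
    _ = _ := by rw [ht]; ring

/-- From `log (r/t) ≤ r/t - 1` follows `t |log t| ≤ t |log r| + r - t`. The threshold `exp (-1)`
ensures `|log r| ≥ 1`, which absorbs the remaining `r`. -/
theorem mul_one_add_abs_log_le {t r : ℝ} (ht : 0 < t) (htr : t ≤ r)
    (hr : r ≤ Real.exp (-1)) : t * (1 + |Real.log t|) ≤ 2 * (r * |Real.log r|) := by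
  have hr0 := ht.trans_le htr
  have hlr : Real.log r ≤ -1 := by
    rw [← Real.log_exp (-1)]; exact Real.log_le_log hr0 hr
  have hlt : Real.log t ≤ Real.log r := Real.log_le_log ht htr
  rw [abs_of_nonpos (by linarith), abs_of_nonpos (by linarith)]
  have h1 : Real.log (r / t) ≤ r / t - 1 := Real.log_le_sub_one_of_pos (by positivity)
  rw [Real.log_div hr0.ne' ht.ne'] at h1
  have h2 : t * (Real.log r - Real.log t) ≤ r - t := by
    calc _ ≤ t * (r / t - 1) := by gcongr
      _ = _ := by field_simp
  nlinarith

theorem exists_mul_one_add_abs_log_le (T : ℝ) :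
    ∃ C, ∀ t, 0 < t → t ≤ T → t * (1 + |Real.log t|) ≤ C := by
  obtain ⟨b, hb⟩ := isCompact_Icc.exists_bound_of_continuousOn (s := Icc 0 T)
    (f := fun t : ℝ => t * Real.log t) Real.continuous_mul_log.continuousOn
  refine ⟨T + b, fun t h0 hT => ?_⟩
  have := hb t ⟨h0.le, hT⟩
  rw [Real.norm_eq_abs, abs_mul, abs_of_pos h0] at this
  linarith

end NPOperator

namespace NPOperator

/-! ### The boundary and its normal -/

open Filter Topology

variable {D U U' : Set Plane} {h h' : Plane → ℝ} {x : Plane}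

theorem eventually_neg_of_hasDerivAt {f : ℝ → ℝ} {c : ℝ} (hf : HasDerivAt f c 0) (h0 : f 0 = 0)
    (hc : c < 0) : ∀ᶠ t in 𝓝[>] 0, f t < 0 := by
  have h1 := (hasDerivAt_iff_tendsto_slope_zero.1 hf).mono_left
    (nhdsWithin_mono 0 fun t (ht : 0 < t) => ht.ne')
  filter_upwards [h1.eventually_lt_const hc, self_mem_nhdsWithin] with t ht ht0
  simp only [zero_add, h0, sub_zero, smul_eq_mul] at ht
  exact (pos_iff_neg_of_mul_neg ht).1 (inv_pos.2 ht0)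

namespace IsDefiningFunction

theorem contDiffAt {m : ℕ∞} (hh : IsDefiningFunction m D U h) (hx : x ∈ U) : ContDiffAt ℝ m h x :=
  hh.contDiffOn.contDiffAt (hh.isOpen.mem_nhds hx)

theorem eq_zero {m : ℕ∞} (hh : IsDefiningFunction m D U h) (hD : IsOpen D) (hx : x ∈ U)
    (hxD : x ∈ frontier D) : h x = 0 := by
  rw [hD.frontier_eq] at hxD
  refine le_antisymm ?_ ?_
  · by_contra! hpos
    have hev : ∀ᶠ y in 𝓝 x, y ∈ U ∧ 0 < h y :=
      (hh.isOpen.eventually_mem hx).and ((hh.contDiffAt hx).continuousAt.eventually_const_lt hpos)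
    obtain ⟨y, hyD, hyU, hy⟩ := (mem_closure_iff_frequently.1 hxD.1).and_eventually hev |>.exists
    have : y ∈ {y ∈ U | h y < 0} := hh.inter_eq ▸ ⟨hyD, hyU⟩
    exact absurd this.2 hy.le.not_gt
  · by_contra! hneg
    have : x ∈ D ∩ U := hh.inter_eq ▸ ⟨hx, hneg⟩
    exact hxD.2 this.1

theorem hasDerivAt_line (hh : IsDefiningFunction 1 D U h) (hx : x ∈ U) (v : Plane) :
    HasDerivAt (fun t : ℝ => h (x + t • v)) ⟪gradient h x, v⟫_ℝ 0 := by
  have h1 := ((hh.contDiffAt hx).differentiableAt (by simp)).hasGradientAt.hasFDerivAt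
  have h2 : HasDerivAt (fun t : ℝ => x + t • v) v 0 := by
    simpa using ((hasDerivAt_id (0 : ℝ)).smul_const v).const_add x
  have h3 : HasFDerivAt h (InnerProductSpace.toDual ℝ Plane (gradient h x)) (x + (0 : ℝ) • v) := by
    simpa using h1
  exact h3.comp_hasDerivAt 0 h2

/-- A short step along `v` enters `D`, so `h'` is negative there as well and cannot have a positive
derivative along `v`. -/
theorem inner_gradient_nonpos (hh : IsDefiningFunction 1 D U h) (hx : x ∈ U) (hx0 : h x = 0)
    (hh' : IsDefiningFunction 1 D U' h') (hx' : x ∈ U') (hx0' : h' x = 0) {v : Plane}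
    (hv : ⟪gradient h x, v⟫_ℝ < 0) : ⟪gradient h' x, v⟫_ℝ ≤ 0 := by
  by_contra! hv'
  have e1 := eventually_neg_of_hasDerivAt (hh.hasDerivAt_line hx v) (by simpa using hx0) hv
  have e2 := eventually_neg_of_hasDerivAt (hh'.hasDerivAt_line hx' v).neg (by simpa using hx0')
    (neg_neg_of_pos hv')
  have hc : Tendsto (fun t : ℝ => x + t • v) (𝓝[>] 0) (𝓝 x) := by
    have : Continuous fun t : ℝ => x + t • v := by fun_prop
    simpa using (this.tendsto 0).mono_left nhdsWithin_le_nhds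
  obtain ⟨t, ht1, ht2, htU, htU'⟩ := (e1.and (e2.and ((hc.eventually (hh.isOpen.mem_nhds hx)).and
    (hc.eventually (hh'.isOpen.mem_nhds hx'))))).exists
  have h1 : x + t • v ∈ D ∩ U := hh.inter_eq ▸ ⟨htU, ht1⟩
  have h2 : x + t • v ∈ {y ∈ U' | h' y < 0} := hh'.inter_eq ▸ ⟨h1.1, htU'⟩
  simp only [Pi.neg_apply] at ht2
  linarith [h2.2]

/-- The normal does not depend on the defining function: if the unit vectors `u`, `u'` differed, `u'
- u` would point inward for `h` and outward for `h'`. -/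
theorem normalize_gradient_eq (hh : IsDefiningFunction 1 D U h) (hx : x ∈ U) (hx0 : h x = 0)
    (hh' : IsDefiningFunction 1 D U' h') (hx' : x ∈ U') (hx0' : h' x = 0) :
    ‖gradient h x‖⁻¹ • gradient h x = ‖gradient h' x‖⁻¹ • gradient h' x := by
  have hp := norm_pos_iff.2 (hh.gradient_ne_zero x hx)
  have hp' := norm_pos_iff.2 (hh'.gradient_ne_zero x hx')
  set u := ‖gradient h x‖⁻¹ • gradient h x with hu
  set u' := ‖gradient h' x‖⁻¹ • gradient h' x with hu'
  have nu : ‖u‖ = 1 := by rw [hu, norm_smul, norm_inv, norm_norm, inv_mul_cancel₀ hp.ne']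
  have nu' : ‖u'‖ = 1 := by rw [hu', norm_smul, norm_inv, norm_norm, inv_mul_cancel₀ hp'.ne']
  by_contra hne
  have hlt : ⟪u, u'⟫_ℝ < 1 := inner_lt_one_iff_real_of_norm_eq_one nu nu' |>.2 hne
  have e1 : ⟪gradient h x, u' - u⟫_ℝ = ‖gradient h x‖ * (⟪u, u'⟫_ℝ - 1) := by
    have : gradient h x = ‖gradient h x‖ • u := by rw [hu, smul_inv_smul₀ hp.ne']
    rw [this, real_inner_smul_left, inner_sub_right, real_inner_self_eq_norm_sq, nu, norm_smul, nu]
    simp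
  have e2 : ⟪gradient h' x, u' - u⟫_ℝ = ‖gradient h' x‖ * (1 - ⟪u, u'⟫_ℝ) := by
    have : gradient h' x = ‖gradient h' x‖ • u' := by rw [hu', smul_inv_smul₀ hp'.ne']
    rw [this, real_inner_smul_left, inner_sub_right, real_inner_self_eq_norm_sq, nu', norm_smul,
      nu', real_inner_comm]
    simp
  have := hh.inner_gradient_nonpos hx hx0 hh' hx' hx0' (v := u' - u)
    (by rw [e1]; exact mul_neg_of_pos_of_neg hp (by linarith))
  rw [e2] at this
  nlinarith

theorem mono {m m' : ℕ∞} (hh : IsDefiningFunction m D U h) (hm : m' ≤ m) :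
    IsDefiningFunction m' D U h :=
  ⟨hh.isOpen, hh.contDiffOn.of_le (by exact_mod_cast hm), hh.gradient_ne_zero, hh.inter_eq⟩

theorem outwardNormal_eq (hh : IsDefiningFunction 1 D U h) (hx : x ∈ U) (hx0 : h x = 0) :
    outwardNormal D x = ‖gradient h x‖⁻¹ • gradient h x := by
  have hex : ∃ n, IsOutwardUnitNormal D x n := ⟨_, U, h, hx, hx0, hh, rfl⟩
  rw [outwardNormal, dif_pos hex]
  obtain ⟨U', h', hx', hx0', hh', he⟩ := hex.choose_spec
  rw [he]
  exact hh'.normalize_gradient_eq hx' hx0' hh hx hx0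

end IsDefiningFunction

theorem norm_outwardNormal_le (D : Set Plane) (x : Plane) : ‖outwardNormal D x‖ ≤ 1 := by
  rw [outwardNormal]
  split_ifs with hex
  · obtain ⟨U, h, -, -, -, he⟩ := hex.choose_spec
    rw [he, norm_smul, norm_inv, norm_norm]
    exact inv_mul_le_one
  · simp

theorem contDiffOn_gradient {n : ℕ∞} (hU : IsOpen U)
    (hh : ContDiffOn ℝ ((n + 1 : ℕ∞) : WithTop ℕ∞) h U) :
    ContDiffOn ℝ n (gradient h) U := by
  have h1 : ContDiffOn ℝ n (fderiv ℝ h) U := hh.fderiv_of_isOpen hU (by push_cast; rfl)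
  rw [contDiffOn_euclidean]
  intro i
  refine (h1.clm_apply (contDiffOn_const (c := EuclideanSpace.single i (1 : ℝ)))).congr
    fun y _ => ?_
  rw [← InnerProductSpace.toDual_symm_apply, ← gradient, EuclideanSpace.inner_single_right]
  simp

namespace IsSmoothDomain

variable {n : ℕ∞}

theorem isCompact_frontier (hD : IsSmoothDomain n D) : IsCompact (frontier D) :=
  Metric.isCompact_of_isClosed_isBounded isClosed_frontier
    (hD.isBounded.closure.subset frontier_subset_closure)

theorem exists_chart (hD : IsSmoothDomain (n + 1) D) (hx : x ∈ frontier D) :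
    ∃ U h, x ∈ U ∧ IsDefiningFunction (n + 1) D U h ∧ ∀ y ∈ U ∩ frontier D,
      h y = 0 ∧ outwardNormal D y = ‖gradient h y‖⁻¹ • gradient h y := by
  obtain ⟨U, h, hxU, hh⟩ := hD.exists_definingFunction x hx
  refine ⟨U, h, hxU, hh, fun y hy => ?_⟩
  have h0 := hh.eq_zero hD.isOpen hy.1 hy.2
  exact ⟨h0, (hh.mono le_add_self).outwardNormal_eq hy.1 h0⟩

/-- The gradient costs one derivative, which is why a `C^(n+1)` boundary gives smoothing of order
`n`. -/
theorem exists_contDiffOn_normal (hD : IsSmoothDomain (n + 1) D) (hx : x ∈ frontier D) :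
    ∃ (U : Set Plane) (N : Plane → Plane), IsOpen U ∧ x ∈ U ∧ ContDiffOn ℝ n N U ∧
      ∀ y ∈ U ∩ frontier D, N y = outwardNormal D y := by
  obtain ⟨U, h, hxU, hh, hy⟩ := hD.exists_chart hx
  refine ⟨U, fun y => ‖gradient h y‖⁻¹ • gradient h y, hh.isOpen, hxU, ?_,
    fun y hyU => (hy y hyU).2.symm⟩
  have hg := contDiffOn_gradient hh.isOpen hh.contDiffOn
  exact ((hg.norm ℝ hh.gradient_ne_zero).inv
    fun y hy => norm_ne_zero_iff.2 (hh.gradient_ne_zero y hy)).smul hg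

theorem continuousOn_outwardNormal (hD : IsSmoothDomain (n + 1) D) :
    ContinuousOn (outwardNormal D) (frontier D) := by
  intro x hx
  obtain ⟨U, N, hU, hxU, hN, hy⟩ := hD.exists_contDiffOn_normal hx
  refine ((hN.continuousOn.continuousAt (hU.mem_nhds hxU)).continuousWithinAt
    (s := frontier D)).congr_of_eventuallyEq ?_ (hy x ⟨hxU, hx⟩).symm
  filter_upwards [mem_nhdsWithin_of_mem_nhds (hU.mem_nhds hxU), self_mem_nhdsWithin] with y h1 h2
  exact (hy y ⟨h1, h2⟩).symm

/-! ### Arc length -/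

/-- Near a boundary point the boundary is close to its tangent line. -/
theorem eventually_inner_gradient_le (hD : IsSmoothDomain (n + 1) D) (hx : x ∈ frontier D) :
    ∃ ν : Plane, ‖ν‖ = 1 ∧ ∀ᶠ p : Plane × Plane in 𝓝 (x, x), p.1 ∈ frontier D →
      p.2 ∈ frontier D → |⟪ν, p.1 - p.2⟫_ℝ| ≤ 1 / 2 * ‖p.1 - p.2‖ := by
  obtain ⟨U, h, hxU, hh, hy⟩ := hD.exists_chart hx
  have hp := norm_pos_iff.2 (hh.gradient_ne_zero x hxU)
  have hd := (hh.contDiffAt hxU).hasStrictFDerivAt (by simp)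
  refine ⟨‖gradient h x‖⁻¹ • gradient h x, ?_, ?_⟩
  · rw [norm_smul, norm_inv, norm_norm, inv_mul_cancel₀ hp.ne']
  -- Strict differentiability controls both points at once; `h` vanishes at each, so only the linear
  -- term survives.
  have hb := hd.isLittleO.bound (half_pos hp)
  filter_upwards [hb, (hh.isOpen.prod hh.isOpen).mem_nhds ⟨hxU, hxU⟩] with p hp1 hpU hf1 hf2
  rw [(hy _ ⟨hpU.1, hf1⟩).1, (hy _ ⟨hpU.2, hf2⟩).1] at hp1
  have : fderiv ℝ h x (p.1 - p.2) = ⟪gradient h x, p.1 - p.2⟫_ℝ := by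
    rw [gradient, InnerProductSpace.toDual_symm_apply]
  rw [this, sub_self, zero_sub, norm_neg, Real.norm_eq_abs] at hp1
  rw [real_inner_smul_left, abs_mul, abs_inv, abs_norm, inv_mul_le_iff₀ hp]
  linarith

/-- Projection to the tangent line is injective on a small piece of the boundary, with 2-Lipschitz
inverse, and the image lies in an interval of length `2r`. -/
theorem exists_hausdorffMeasure_le (hD : IsSmoothDomain (n + 1) D) (hx : x ∈ frontier D) :
    ∃ r₀ > 0, ∀ r, 0 < r → r < r₀ →
      (μH[1] : Measure Plane) (frontier D ∩ Metric.ball x r) ≤ ENNReal.ofReal (4 * r) := by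
  obtain ⟨ν, hν, hev⟩ := hD.eventually_inner_gradient_le hx
  obtain ⟨r₀, hr₀, hball⟩ := Metric.eventually_nhds_iff_ball.1 hev
  refine ⟨r₀, hr₀, fun r hr hrr => ?_⟩
  set A := frontier D ∩ Metric.ball x r with hA
  let τ : Plane := !₂[-ν 1, ν 0]
  have key : ∀ w : Plane, ‖w‖ ^ 2 = ⟪ν, w⟫_ℝ ^ 2 + ⟪τ, w⟫_ℝ ^ 2 := fun w => by
    have h1 : ν 0 ^ 2 + ν 1 ^ 2 = 1 := by
      have := EuclideanSpace.real_norm_sq_eq ν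
      rw [hν, Fin.sum_univ_two] at this
      linarith
    rw [EuclideanSpace.real_norm_sq_eq]
    simp only [PiLp.inner_apply, Fin.sum_univ_two, τ, RCLike.inner_apply, conj_trivial]
    simp
    linear_combination (-(w 0 ^ 2 + w 1 ^ 2)) * h1
  let p : Plane → ℝ := fun y => ⟪τ, y⟫_ℝ
  -- The normal component is at most half the length, so the square of the tangential one is at
  -- least `3/4` of the squared length.
  have anti : ∀ y ∈ A, ∀ y' ∈ A, dist y y' ≤ 2 * dist (p y) (p y') := by
    intro y hy y' hy'
    have h1 := hball (y, y') (by
      rw [← ball_prod_same]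
      exact ⟨Metric.ball_subset_ball hrr.le hy.2, Metric.ball_subset_ball hrr.le hy'.2⟩) hy.1 hy'.1
    simp only at h1
    have h2 := key (y - y')
    rw [dist_eq_norm, Real.dist_eq, ← inner_sub_right]
    rw [← sq_abs ⟪ν, y - y'⟫_ℝ, ← sq_abs ⟪τ, y - y'⟫_ℝ] at h2
    have h3 : |⟪ν, y - y'⟫_ℝ| ^ 2 ≤ (1 / 2 * ‖y - y'‖) ^ 2 := by gcongr
    refine abs_le_of_sq_le_sq' ?_ (by positivity) |>.2
    nlinarith [sq_nonneg ‖y - y'‖]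
  have hinj : InjOn p A := fun y hy y' hy' he => by
    have := anti y hy y' hy'
    rw [he, dist_self, mul_zero] at this
    exact dist_le_zero.1 this
  have hlip : LipschitzOnWith 2 (Function.invFunOn p A) (p '' A) := by
    refine LipschitzOnWith.of_dist_le_mul ?_
    rintro _ ⟨y, hy, rfl⟩ _ ⟨y', hy', rfl⟩
    rw [hinj.leftInvOn_invFunOn hy, hinj.leftInvOn_invFunOn hy']
    exact anti y hy y' hy'
  have hτ : ‖τ‖ ≤ 1 := by
    have h1 := EuclideanSpace.real_norm_sq_eq ν
    have h2 := EuclideanSpace.real_norm_sq_eq τ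
    rw [hν, Fin.sum_univ_two] at h1
    rw [Fin.sum_univ_two] at h2
    simp [τ] at h2
    refine abs_le_of_sq_le_sq' ?_ zero_le_one |>.2
    linarith
  have hsub : p '' A ⊆ Metric.ball (p x) r := by
    rintro _ ⟨y, hy, rfl⟩
    rw [Metric.mem_ball, Real.dist_eq, ← inner_sub_right]
    refine (abs_real_inner_le_norm _ _).trans_lt ?_
    have := hy.2
    rw [Metric.mem_ball, dist_eq_norm] at this
    nlinarith [norm_nonneg (y - x)]
  have himg : Function.invFunOn p A '' (p '' A) = A := by
    rw [image_image]
    exact (image_congr fun y hy => hinj.leftInvOn_invFunOn hy).trans (image_id' _)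
  calc (μH[1] : Measure Plane) A = μH[1] (Function.invFunOn p A '' (p '' A)) := by rw [himg]
    _ ≤ ((2 : ℝ≥0) : ℝ≥0∞) ^ (1 : ℝ) * μH[1] (p '' A) := hlip.hausdorffMeasure_image_le zero_le_one
    _ ≤ ((2 : ℝ≥0) : ℝ≥0∞) ^ (1 : ℝ) * volume (Metric.ball (p x) r) := by
        rw [hausdorffMeasure_real]; gcongr
    _ = ENNReal.ofReal (4 * r) := by
        rw [Real.volume_ball, ENNReal.rpow_one, show ((2 : ℝ≥0) : ℝ≥0∞) = ENNReal.ofReal 2 by simp,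
          ← ENNReal.ofReal_mul zero_le_two]
        congr 1; ring

theorem isFiniteMeasure_arcLength (hD : IsSmoothDomain (n + 1) D) :
    IsFiniteMeasure (arcLength D) := by
  refine ⟨?_⟩
  rw [arcLength, Measure.restrict_apply_univ]
  refine hD.isCompact_frontier.measure_lt_top_of_nhdsWithin fun x hx => ?_
  obtain ⟨r₀, hr₀, h⟩ := hD.exists_hausdorffMeasure_le hx
  exact ⟨_, inter_mem_nhdsWithin _ (Metric.ball_mem_nhds x (half_pos hr₀)),
    (h _ (half_pos hr₀) (half_lt_self hr₀)).trans_lt ENNReal.ofReal_lt_top⟩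

/-! ### The curvature bound -/

/-- First-order Taylor expansion of `h` at `p.1`: its values at both points vanish, and the
remainder is quadratic because `n ≥ 1` makes the derivative Lipschitz. -/
theorem eventually_inner_normal_le (hD : IsSmoothDomain (n + 1) D) (hn : 1 ≤ n)
    (hx : x ∈ frontier D) : ∃ C : ℝ, ∀ᶠ p : Plane × Plane in 𝓝 (x, x), p.1 ∈ frontier D →
      p.2 ∈ frontier D → |⟪p.1 - p.2, outwardNormal D p.1⟫_ℝ| ≤ C * ‖p.1 - p.2‖ ^ 2 := by
  obtain ⟨U, h, hxU, hh, hy⟩ := hD.exists_chart hx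
  have hfd : ContDiffAt ℝ 1 (fderiv ℝ h) x :=
    (hh.contDiffAt hxU).fderiv_right (by push_cast; gcongr; exact_mod_cast hn)
  obtain ⟨K, t, ht, hK⟩ := hfd.exists_lipschitzOnWith
  have hg : ContinuousAt (gradient h) x :=
    (contDiffOn_gradient hh.isOpen hh.contDiffOn).continuousOn.continuousAt (hh.isOpen.mem_nhds hxU)
  have hp := norm_pos_iff.2 (hh.gradient_ne_zero x hxU)
  have hev : ∀ᶠ y in 𝓝 x, y ∈ U ∧ y ∈ t ∧ ‖gradient h x‖ / 2 < ‖gradient h y‖ :=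
    (hh.isOpen.eventually_mem hxU).and (Filter.Eventually.and ht
      (hg.norm.eventually_const_lt (half_lt_self hp)))
  obtain ⟨r, hr, hball⟩ := Metric.eventually_nhds_iff_ball.1 hev
  refine ⟨(‖gradient h x‖ / 2)⁻¹ * K, ?_⟩
  filter_upwards [prod_mem_nhds (Metric.ball_mem_nhds x hr) (Metric.ball_mem_nhds x hr)]
    with p hpb hf1 hf2
  obtain ⟨hU1, -, hgr⟩ := hball _ hpb.1
  have hU2 := (hball _ hpb.2).1
  have hseg : segment ℝ p.1 p.2 ⊆ Metric.ball x r :=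
    (convex_ball x r).segment_subset hpb.1 hpb.2
  have hmv := (convex_segment p.1 p.2).norm_image_sub_le_of_norm_fderiv_le' (𝕜 := ℝ) (f := h)
    (C := K * ‖p.2 - p.1‖) (φ := fderiv ℝ h p.1)
    (fun y hy => (hh.contDiffAt (hball y (hseg hy)).1).differentiableAt (by simp))
    (fun y hy => by
      have h1 := hK.dist_le_mul y (hball y (hseg hy)).2.1 p.1 (hball _ hpb.1).2.1
      rw [dist_eq_norm, dist_eq_norm] at h1
      refine h1.trans (mul_le_mul_of_nonneg_left ?_ K.2)
      rw [← dist_eq_norm, ← dist_eq_norm, dist_comm p.2]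
      exact Metric.mem_closedBall.1 (segment_subset_closedBall_left p.1 p.2 hy))
    (left_mem_segment ℝ _ _) (right_mem_segment ℝ _ _)
  have : fderiv ℝ h p.1 (p.2 - p.1) = -⟪p.1 - p.2, gradient h p.1⟫_ℝ := by
    rw [← inner_neg_left, neg_sub, real_inner_comm, gradient, InnerProductSpace.toDual_symm_apply]
  rw [(hy _ ⟨hU1, hf1⟩).1, (hy _ ⟨hU2, hf2⟩).1, this, sub_self, zero_sub, neg_neg,
    Real.norm_eq_abs, norm_sub_rev p.2 p.1] at hmv
  rw [(hy _ ⟨hU1, hf1⟩).2, real_inner_smul_right, abs_mul, abs_inv, abs_norm, mul_assoc]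
  have : ‖gradient h p.1‖⁻¹ ≤ (‖gradient h x‖ / 2)⁻¹ := inv_anti₀ (half_pos hp) hgr.le
  calc _ ≤ (‖gradient h x‖ / 2)⁻¹ * (K * ‖p.1 - p.2‖ * ‖p.1 - p.2‖) := by gcongr
    _ = _ := by ring

/-- Compactness of `∂D × ∂D`: Taylor expansion handles the diagonal, and elsewhere `|x - y|` is
locally bounded below, so Cauchy–Schwarz suffices. -/
theorem exists_inner_normal_le (hD : IsSmoothDomain (n + 1) D) (hn : 1 ≤ n) :
    ∃ C : ℝ, 0 ≤ C ∧ ∀ x ∈ frontier D, ∀ y ∈ frontier D,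
      |⟪x - y, outwardNormal D x⟫_ℝ| ≤ C * ‖x - y‖ ^ 2 := by
  suffices ∃ C : ℝ, ∀ p ∈ frontier D ×ˢ frontier D,
      |⟪p.1 - p.2, outwardNormal D p.1⟫_ℝ| ≤ C * ‖p.1 - p.2‖ ^ 2 by
    obtain ⟨C, hC⟩ := this
    exact ⟨|C|, abs_nonneg C, fun x hx y hy => (hC (x, y) ⟨hx, hy⟩).trans
      (mul_le_mul_of_nonneg_right (le_abs_self C) (by positivity))⟩
  refine (hD.isCompact_frontier.prod hD.isCompact_frontier).induction_on (p := fun s => ∃ C : ℝ,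
    ∀ p ∈ s, |⟪p.1 - p.2, outwardNormal D p.1⟫_ℝ| ≤ C * ‖p.1 - p.2‖ ^ 2) ⟨0, by simp⟩
    (fun s t hst ⟨C, hC⟩ => ⟨C, fun p hp => hC p (hst hp)⟩) ?_ ?_
  · rintro s t ⟨C, hC⟩ ⟨C', hC'⟩
    refine ⟨max C C', fun p hp => ?_⟩
    rcases hp with hp | hp
    · exact (hC p hp).trans (by gcongr; exact le_max_left _ _)
    · exact (hC' p hp).trans (by gcongr; exact le_max_right _ _)
  · rintro ⟨x, y⟩ ⟨hx, hy⟩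
    simp only at hx hy
    rcases eq_or_ne x y with rfl | hne
    · obtain ⟨C, hC⟩ := hD.eventually_inner_normal_le hn hx
      refine ⟨_, inter_mem_nhdsWithin _ hC, C, ?_⟩
      rintro p ⟨⟨h1, h2⟩, h3⟩
      exact h3 h1 h2
    · have hd : 0 < ‖x - y‖ / 2 := half_pos (norm_pos_iff.2 (sub_ne_zero.2 hne))
      have hev : ∀ᶠ p : Plane × Plane in 𝓝 (x, y), ‖x - y‖ / 2 < ‖p.1 - p.2‖ :=
        (Continuous.tendsto (f := fun p : Plane × Plane => ‖p.1 - p.2‖) (by fun_prop)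
          (x, y)).eventually_const_lt (half_lt_self (by linarith))
      refine ⟨_, mem_nhdsWithin_of_mem_nhds hev, (‖x - y‖ / 2)⁻¹, fun p hp => ?_⟩
      have hp' : ‖x - y‖ / 2 < ‖p.1 - p.2‖ := hp
      calc |⟪p.1 - p.2, outwardNormal D p.1⟫_ℝ| ≤ ‖p.1 - p.2‖ * 1 :=
            (abs_real_inner_le_norm _ _).trans
              (mul_le_mul_of_nonneg_left (norm_outwardNormal_le D p.1) (norm_nonneg _))
        _ ≤ _ := by
            rw [← div_eq_inv_mul, le_div_iff₀ hd, mul_one, sq]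
            gcongr

end IsSmoothDomain

end NPOperator

namespace NPOperator

/-! ### Integral operators with bounded kernels -/

open Filter Topology

section BoundedKernel

variable {μ ν : Measure Plane} [IsFiniteMeasure μ] [IsFiniteMeasure ν]

theorem integral_norm_le_sqrt_mul_norm (φ : Lp ℂ 2 μ) :
    ∫ y, ‖φ y‖ ∂μ ≤ √(μ.real univ) * ‖φ‖ := by
  have h := eLpNorm_le_eLpNorm_mul_rpow_measure_univ (p := 1) (q := 2) (μ := μ) one_le_two
    (Lp.aestronglyMeasurable φ)
  have htop : eLpNorm φ 2 μ * μ univ ^ (1 / (1 : ℝ≥0∞).toReal - 1 / (2 : ℝ≥0∞).toReal) ≠ ⊤ := by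
    refine ENNReal.mul_ne_top (Lp.eLpNorm_ne_top φ) (ENNReal.rpow_ne_top_of_nonneg ?_ (by simp))
    norm_num
  have h' := ENNReal.toReal_mono htop h
  rw [eLpNorm_one_eq_lintegral_enorm, ← integral_norm_eq_lintegral_enorm
    (Lp.aestronglyMeasurable φ), ENNReal.toReal_mul, ← ENNReal.toReal_rpow, ← Lp.norm_def] at h'
  refine h'.trans (le_of_eq ?_)
  rw [mul_comm, Real.sqrt_eq_rpow, Measure.real]
  norm_num

/-- A bounded kernel on finite measure spaces is the kernel of a bounded operator on `L²`. -/
theorem exists_isIntegralOperator {κ : Plane → Plane → ℂ}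
    (hκ : AEStronglyMeasurable (Function.uncurry κ) (ν.prod μ)) {M : ℝ} (hM : 0 ≤ M)
    (hb : ∀ᵐ x ∂ν, ∀ᵐ y ∂μ, ‖κ x y‖ ≤ M) :
    ∃ A : Lp ℂ 2 μ →L[ℂ] Lp ℂ 2 ν, IsIntegralOperator κ A ∧
      ‖A‖ ≤ M * (√(μ.real univ) * √(ν.real univ)) := by
  have hφ : ∀ φ : Lp ℂ 2 μ, Integrable φ μ := fun φ => (Lp.memLp φ).integrable one_le_two
  have hint : ∀ φ : Lp ℂ 2 μ, ∀ᵐ x ∂ν, Integrable (fun y => κ x y * φ y) μ := fun φ => by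
    filter_upwards [hκ.prodMk_left, hb] with x hx hxb
    exact (hφ φ).bdd_mul hx hxb
  -- The bound is uniform in `x`; taking the `L²` norm in `x` then costs the second square root of a
  -- total mass.
  have hbd : ∀ φ : Lp ℂ 2 μ, ∀ᵐ x ∂ν,
      ‖∫ y, κ x y * φ y ∂μ‖ ≤ M * (√(μ.real univ) * ‖φ‖) := fun φ => by
    filter_upwards [hb] with x hxb
    calc ‖∫ y, κ x y * φ y ∂μ‖ ≤ ∫ y, M * ‖φ y‖ ∂μ := by
          refine norm_integral_le_of_norm_le ((hφ φ).norm.const_mul M) ?_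
          filter_upwards [hxb] with y hy
          rw [norm_mul]
          gcongr
      _ = M * ∫ y, ‖φ y‖ ∂μ := integral_const_mul _ _
      _ ≤ _ := by gcongr; exact integral_norm_le_sqrt_mul_norm φ
  have hmem : ∀ φ : Lp ℂ 2 μ, MemLp (fun x => ∫ y, κ x y * φ y ∂μ) 2 ν := fun φ =>
    MemLp.of_bound (hκ.mul (Lp.aestronglyMeasurable φ).comp_snd).integral_prod_right' _ (hbd φ)
  let L : Lp ℂ 2 μ →ₗ[ℂ] Lp ℂ 2 ν :=
    { toFun := fun φ => (hmem φ).toLp _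
      map_add' := fun φ ψ => by
        rw [← MemLp.toLp_add]
        refine MemLp.toLp_congr _ _ ?_
        filter_upwards [hint φ, hint ψ] with x h1 h2
        rw [Pi.add_apply, ← integral_add h1 h2]
        refine integral_congr_ae ?_
        filter_upwards [Lp.coeFn_add φ ψ] with y hy
        rw [hy, Pi.add_apply, mul_add]
      map_smul' := fun c φ => by
        rw [RingHom.id_apply, ← MemLp.toLp_const_smul]
        refine MemLp.toLp_congr _ _ (Eventually.of_forall fun x => ?_)
        rw [Pi.smul_apply, ← integral_smul]
        refine integral_congr_ae ?_
        filter_upwards [Lp.coeFn_smul c φ] with y hy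
        rw [hy, Pi.smul_apply, smul_eq_mul, smul_eq_mul]
        ring }
  have hL : ∀ φ, ‖L φ‖ ≤ M * (√(μ.real univ) * √(ν.real univ)) * ‖φ‖ := fun φ => by
    refine (Lp.norm_le_of_ae_bound (C := M * (√(μ.real univ) * ‖φ‖)) (by positivity) ?_).trans
      (le_of_eq ?_)
    · filter_upwards [hbd φ, (hmem φ).coeFn_toLp] with x h1 h2
      have : L φ x = ∫ y, κ x y * φ y ∂μ := h2
      rwa [this]
    · rw [Real.sqrt_eq_rpow (ν.real univ)]
      have : ((measureUnivNNReal ν : ℝ≥0) : ℝ) = ν.real univ := rfl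
      rw [this]
      norm_num
      ring
  refine ⟨L.mkContinuous _ hL, fun φ => ?_, L.mkContinuous_norm_le (by positivity) hL⟩
  filter_upwards [hint φ, (hmem φ).coeFn_toLp] with x h1 h2
  exact ⟨h1, h2⟩

end BoundedKernel

/-! ### The Neumann–Poincaré kernels -/

section Kernels

variable {D : Set Plane} {n : ℕ∞}

theorem ae_mem_frontier (D : Set Plane) : ∀ᵐ x ∂arcLength D, x ∈ frontier D :=
  ae_restrict_mem isClosed_frontier.measurableSet

instance nullSingletonClass_arcLength (D : Set Plane) : NullSingletonClass (arcLength D) :=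
  have := Measure.nullSingletonClass_hausdorff Plane zero_lt_one
  inferInstanceAs (NullSingletonClass ((μH[1] : Measure Plane).restrict (frontier D)))

theorem ae_ae_mem_frontier_ne (D : Set Plane) : ∀ᵐ x ∂arcLength D, ∀ᵐ y ∂arcLength D,
    (x ∈ frontier D ∧ y ∈ frontier D) ∧ x ≠ y := by
  filter_upwards [ae_mem_frontier D] with x hx
  filter_upwards [ae_mem_frontier D, compl_mem_ae_iff.2 (measure_singleton x)] with y hy hne
  exact ⟨⟨hx, hy⟩, fun h => hne h.symm⟩

/-- Arc length has no atoms, so the diagonal is null for the product measure, and continuity and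
bounds off it suffice. -/
theorem IsSmoothDomain.exists_isIntegralOperator (hD : IsSmoothDomain (n + 1) D)
    {κ : Plane → Plane → ℂ}
    (hκ : ContinuousOn (Function.uncurry κ) (frontier D ×ˢ frontier D ∩ (diagonal Plane)ᶜ))
    {μ ν : Measure Plane} (hμ : μ ≤ arcLength D) (hν : ν ≤ arcLength D) {M : ℝ} (hM : 0 ≤ M)
    (hb : ∀ᵐ x ∂ν, ∀ᵐ y ∂μ, x ∈ frontier D → y ∈ frontier D → x ≠ y → ‖κ x y‖ ≤ M) :
    ∃ A : Lp ℂ 2 μ →L[ℂ] Lp ℂ 2 ν, IsIntegralOperator κ A ∧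
      ‖A‖ ≤ M * (√(μ.real univ) * √(ν.real univ)) := by
  have := hD.isFiniteMeasure_arcLength
  have hfμ : IsFiniteMeasure μ := isFiniteMeasure_of_le _ hμ
  have : IsFiniteMeasure ν := isFiniteMeasure_of_le _ hν
  have hμ' := Measure.absolutelyContinuous_of_le hμ
  have hν' := Measure.absolutelyContinuous_of_le hν
  have hmeas : MeasurableSet (frontier D ×ˢ frontier D ∩ (diagonal Plane)ᶜ) :=
    (isClosed_frontier.measurableSet.prod isClosed_frontier.measurableSet).inter
      isClosed_diagonal.measurableSet.compl
  have hae : ∀ᵐ p ∂(arcLength D).prod (arcLength D),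
      p ∈ frontier D ×ˢ frontier D ∩ (diagonal Plane)ᶜ :=
    (Measure.ae_prod_mem_iff_ae_ae_mem hmeas).2 (ae_ae_mem_frontier_ne D)
  have hsm := hκ.aestronglyMeasurable (μ := (arcLength D).prod (arcLength D)) hmeas
  rw [Measure.restrict_eq_self_of_ae_mem hae] at hsm
  refine NPOperator.exists_isIntegralOperator (hsm.mono_ac (hν'.prod hμ')) hM ?_
  filter_upwards [hb, hν'.ae_le (ae_ae_mem_frontier_ne D)] with x h1 h2
  filter_upwards [h1, hμ'.ae_le h2] with y h3 h4
  exact h3 h4.1.1 h4.1.2 h4.2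

theorem contDiffAt_fderiv_helmholtzG {k : ℝ} (hk : 0 < k) {z : Plane} (hz : z ≠ 0) :
    ContDiffAt ℝ n (fderiv ℝ (helmholtzG k)) z :=
  (contDiffAt_helmholtzG hk hz).fderiv_right (by exact_mod_cast le_top)

namespace IsSmoothDomain

theorem continuousOn_helmholtzKernel (hD : IsSmoothDomain (n + 1) D) {k : ℝ} (hk : 0 < k) :
    ContinuousOn (Function.uncurry (helmholtzKernel D k))
      (frontier D ×ˢ frontier D ∩ (diagonal Plane)ᶜ) := by
  refine ContinuousOn.clm_apply (f := fun p : Plane × Plane => fderiv ℝ (helmholtzG k) (p.1 - p.2))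
    (g := fun p => outwardNormal D p.1) (fun p hp => ?_) ?_
  · have h1 : ContinuousAt (fderiv ℝ (helmholtzG k)) (p.1 - p.2) :=
      (contDiffAt_fderiv_helmholtzG (n := 0) hk (sub_ne_zero.2 hp.2)).continuousAt
    exact (ContinuousAt.comp (f := fun p : Plane × Plane => p.1 - p.2) h1
      (by fun_prop)).continuousWithinAt
  · exact hD.continuousOn_outwardNormal.comp continuousOn_fst fun p hp => hp.1.1

theorem continuousOn_laplaceKernel (hD : IsSmoothDomain (n + 1) D) :
    ContinuousOn (Function.uncurry (laplaceKernel D))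
      (frontier D ×ˢ frontier D ∩ (diagonal Plane)ᶜ) := by
  refine Complex.continuous_ofReal.comp_continuousOn (continuousOn_const.mul (ContinuousOn.div ?_ ?_
    fun p hp => ?_))
  · exact ContinuousOn.inner (𝕜 := ℝ) (by fun_prop)
      (hD.continuousOn_outwardNormal.comp continuousOn_fst fun p hp => hp.1.1)
  · fun_prop
  · exact pow_ne_zero 2 (norm_ne_zero_iff.2 (sub_ne_zero.2 hp.2))

theorem exists_norm_laplaceKernel_le (hD : IsSmoothDomain (n + 1) D) (hn : 1 ≤ n) :
    ∃ M, 0 ≤ M ∧ ∀ x ∈ frontier D, ∀ y ∈ frontier D, ‖laplaceKernel D x y‖ ≤ M := by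
  obtain ⟨C, hC, h⟩ := hD.exists_inner_normal_le hn
  refine ⟨1 / (2 * Real.pi) * C, by positivity, fun x hx y hy => ?_⟩
  rw [laplaceKernel, Complex.norm_real, Real.norm_eq_abs, abs_mul,
    abs_of_nonneg (by positivity : 0 ≤ 1 / (2 * Real.pi)), abs_div,
    abs_of_nonneg (sq_nonneg ‖x - y‖)]
  gcongr
  -- This also covers `x = y`, where the quotient is `0` by convention.
  exact div_le_of_le_mul₀ (by positivity) hC (h x hx y hy)

/-- The bound may depend on `k`: it serves only to show that the operators exist and are bounded. -/
theorem exists_norm_helmholtz_sub_laplace_le (hD : IsSmoothDomain n D) {k : ℝ} (hk : 0 < k) :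
    ∃ M, 0 ≤ M ∧ ∀ x ∈ frontier D, ∀ y ∈ frontier D, x ≠ y →
      ‖helmholtzKernel D k x y - laplaceKernel D x y‖ ≤ M := by
  obtain ⟨R, hR⟩ := hD.isCompact_frontier.isBounded.exists_norm_le
  obtain ⟨C, hC, h⟩ := NPOperator.exists_norm_helmholtz_sub_laplace_le (k * (R + R) / 2)
  obtain ⟨C', h'⟩ := exists_mul_one_add_abs_log_le (k * (R + R) / 2)
  refine ⟨C * k * |C'|, by positivity, fun x hx y hy hxy => ?_⟩
  have hz : 0 < ‖x - y‖ := norm_pos_iff.2 (sub_ne_zero.2 hxy)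
  have hT : k * ‖x - y‖ / 2 ≤ k * (R + R) / 2 := by
    have := (norm_sub_le x y).trans (add_le_add (hR x hx) (hR y hy))
    gcongr
  refine (h D k x y hk hxy hT (norm_outwardNormal_le D x)).trans ?_
  gcongr
  exact (h' _ (by positivity) hT).trans (le_abs_self C')

end IsSmoothDomain

/-! ### Smoothing operators -/

/-- A function which is smooth away from the origin, cut off to an annulus. -/
theorem exists_contDiff_hasCompactSupport_eq {E : Type*} [NormedAddCommGroup E] [NormedSpace ℝ E]
    {H : Plane → E} (hH : ∀ z, z ≠ 0 → ContDiffAt ℝ n H z) {δ R : ℝ} (hδ : 0 < δ) :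
    ∃ g : Plane → E, ContDiff ℝ n g ∧ HasCompactSupport g ∧
      ∀ z, δ ≤ ‖z‖ → ‖z‖ ≤ R → g z = H z := by
  let χ₁ : ContDiffBump (0 : Plane) := ⟨δ / 2, δ, half_pos hδ, half_lt_self hδ⟩
  let χ₂ : ContDiffBump (0 : Plane) := ⟨|R| + δ, |R| + δ + 1, by positivity, by linarith⟩
  -- `1 - χ₁` removes the singularity at the origin, and `χ₂` makes the support compact.
  refine ⟨fun z => χ₂ z • (1 - χ₁ z) • H z, ?_, χ₂.hasCompactSupport.smul_right, fun z h1 h2 => ?_⟩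
  · rw [contDiff_iff_contDiffAt]
    intro z
    rcases eq_or_ne z 0 with rfl | hz
    · refine (contDiffAt_const (c := (0 : E))).congr_of_eventuallyEq ?_
      filter_upwards [χ₁.eventuallyEq_one] with z hz
      rw [hz, Pi.one_apply, sub_self, zero_smul, smul_zero]
    · exact χ₂.contDiffAt.smul ((contDiffAt_const.sub χ₁.contDiffAt).smul (hH z hz))
  · have e1 : χ₁ z = 0 := χ₁.zero_of_le_dist (by rwa [dist_zero_right])
    have e2 : χ₂ z = 1 := χ₂.one_of_mem_closedBall (by
      rw [mem_closedBall_zero_iff]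
      exact h2.trans ((le_abs_self R).trans (le_add_of_nonneg_right hδ.le)))
    simp only [e1, e2, sub_zero, one_smul]

/-- Away from the singularity, `x ↦ ∫ ∇G(x - y) φ(y) dμ(y)` is smooth. -/
theorem exists_contDiff_integral_fderiv_helmholtzG {k : ℝ} (hk : 0 < k) {μ : Measure Plane}
    {φ : Plane → ℂ} (hφ : Integrable φ μ) {x₀ : Plane} {δ R : ℝ} (hδ : 0 < δ)
    (hμ : ∀ᵐ y ∂μ, 2 * δ ≤ ‖x₀ - y‖ ∧ ‖x₀ - y‖ ≤ R) :
    ∃ Ψ : Plane → Plane →L[ℝ] ℂ, ContDiff ℝ n Ψ ∧ ∀ x ∈ Metric.ball x₀ δ, ∀ v,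
      Ψ x v = ∫ y, fderiv ℝ (helmholtzG k) (x - y) v * φ y ∂μ := by
  obtain ⟨g, hg, hgc, hge⟩ := exists_contDiff_hasCompactSupport_eq (n := n) (R := R + δ)
    (fun z hz => contDiffAt_fderiv_helmholtzG hk hz) hδ
  let L : ℂ →L[ℝ] (Plane →L[ℝ] ℂ) →L[ℝ] (Plane →L[ℝ] ℂ) := ContinuousLinearMap.lsmul ℝ ℂ
  -- For `x` within `δ` of `x₀`, the differences `x - y` stay in the annulus where `g` is the true
  -- kernel. The integral is thus a convolution with a compactly supported `C^n` function.
  refine ⟨_, hgc.contDiff_convolution_right L hφ.locallyIntegrable hg, fun x hx v => ?_⟩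
  have hex : Integrable (fun y => L (φ y) (g (x - y))) μ :=
    hgc.convolutionExists_right L hφ.locallyIntegrable hg.continuous x
  refine (ContinuousLinearMap.integral_apply hex v).trans (integral_congr_ae ?_)
  filter_upwards [hμ] with y hy
  have hxx : ‖x - x₀‖ < δ := by rwa [Metric.mem_ball, dist_eq_norm] at hx
  have h1 : δ ≤ ‖x - y‖ := by
    have : ‖x₀ - y‖ ≤ ‖x - y‖ + ‖x - x₀‖ := by
      have := norm_sub_le (x - y) (x - x₀)
      rwa [sub_sub_sub_cancel_left] at this
    linarith
  have h2 : ‖x - y‖ ≤ R + δ := by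
    have := norm_add_le (x - x₀) (x₀ - y)
    rw [sub_add_sub_cancel] at this
    linarith
  rw [hge _ h1 h2, mul_comm]
  rfl

theorem IsSmoothDomain.isSmoothing (hD : IsSmoothDomain (n + 1) D) {k : ℝ} (hk : 0 < k)
    {xR : Plane} {ρ : ℝ} {T : L2 D (farPart D xR ρ) →L[ℂ] L2 D (nearPart D xR ρ)}
    (hT : IsIntegralOperator (helmholtzKernel D k) T) : IsSmoothing n T := by
  refine ⟨⟨helmholtzKernel D k, ?_, hT⟩, fun φ => ⟨fun x => ∫ y, helmholtzKernel D k x y * φ y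
    ∂(arcLength D).restrict (farPart D xR ρ), fun x₀ hx₀ => ?_, (hT φ).mono fun x hx => hx.2⟩⟩
  · rintro ⟨x₀, y₀⟩ ⟨hx₀, hy₀⟩
    obtain ⟨U, N, hU, hxU, hN, he⟩ := hD.exists_contDiffOn_normal hx₀.1
    refine ⟨(U ×ˢ univ) ∩ (diagonal Plane)ᶜ,
      fun p => fderiv ℝ (helmholtzG k) (p.1 - p.2) (N p.1),
      (hU.prod isOpen_univ).inter isClosed_diagonal.isOpen_compl, ⟨⟨hxU, mem_univ _⟩, ?_⟩, ?_, ?_⟩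
    · rintro (rfl : x₀ = y₀)
      exact hy₀.2 hx₀
    · refine ContDiffOn.clm_apply (fun p hp => ?_)
        (hN.comp contDiff_fst.contDiffOn fun p hp => hp.1.1)
      exact (ContDiffAt.comp (f := fun p : Plane × Plane => p.1 - p.2) p
        (contDiffAt_fderiv_helmholtzG hk (sub_ne_zero.2 hp.2))
        (contDiff_fst.sub contDiff_snd).contDiffAt).contDiffWithinAt
    · rintro p ⟨⟨⟨hp, -⟩, -⟩, hp1, -⟩
      simp only [helmholtzKernel, he p.1 ⟨hp, hp1.1⟩]
  · have := hD.isFiniteMeasure_arcLength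
    obtain ⟨U, N, hU, hxU, hN, he⟩ := hD.exists_contDiffOn_normal hx₀.1
    obtain ⟨R, hR⟩ := hD.isCompact_frontier.isBounded.exists_norm_le
    have hlt : dist x₀ xR < ρ := hx₀.2
    have hmeas : MeasurableSet (farPart D xR ρ) := isClosed_frontier.measurableSet.diff
      (isClosed_frontier.measurableSet.inter Metric.isOpen_ball.measurableSet)
    -- The distance from `x₀` to `Γ₂` is at least `ρ - |x₀ - xR| > 0`. It has no positive lower
    -- bound over `Γ₁` in general, but smoothness is a local property.
    obtain ⟨Ψ, hΨ, hΨe⟩ := exists_contDiff_integral_fderiv_helmholtzG (n := n) hk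
      ((Lp.memLp φ).integrable one_le_two) (x₀ := x₀) (δ := (ρ - dist x₀ xR) / 2) (R := R + R)
      (by linarith) (by
        filter_upwards [ae_restrict_mem hmeas] with y hy
        have h1 : ρ ≤ dist y xR := by
          by_contra! h
          exact hy.2 ⟨hy.1, h⟩
        refine ⟨?_, (norm_sub_le _ _).trans (add_le_add (hR _ hx₀.1) (hR _ hy.1))⟩
        rw [← dist_eq_norm]
        linarith [dist_triangle_left y xR x₀])
    refine ⟨U ∩ Metric.ball x₀ ((ρ - dist x₀ xR) / 2), fun x => Ψ x (N x),
      hU.inter Metric.isOpen_ball, ⟨hxU, Metric.mem_ball_self (by linarith)⟩,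
      hΨ.contDiffOn.clm_apply (hN.mono inter_subset_left), ?_⟩
    rintro x ⟨⟨hx1, hx2⟩, hx3⟩
    simp only [hΨe x hx2, he x ⟨hx1, hx3.1⟩, helmholtzKernel]

end Kernels

/-! ### The decomposition -/

theorem restrictTo_apply_eq {D Γ₁ Γ₂ : Set Plane} {k : ℝ} (hm₂ : MeasurableSet Γ₂)
    (hdisj : Disjoint Γ₁ Γ₂) (hunion : Γ₁ ∪ Γ₂ = frontier D)
    {Kk : Lp ℂ 2 (arcLength D) →L[ℂ] Lp ℂ 2 (arcLength D)}
    {K₁ R : L2 D Γ₁ →L[ℂ] L2 D Γ₁} {T : L2 D Γ₂ →L[ℂ] L2 D Γ₁}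
    (hK : IsIntegralOperator (helmholtzKernel D k) Kk)
    (hK₁ : IsIntegralOperator (laplaceKernel D) K₁)
    (hR : IsIntegralOperator (fun x y => helmholtzKernel D k x y - laplaceKernel D x y) R)
    (hT : IsIntegralOperator (helmholtzKernel D k) T) (φ : Lp ℂ 2 (arcLength D)) :
    restrictTo D Γ₁ (Kk φ) =
      K₁ (restrictTo D Γ₁ φ) + R (restrictTo D Γ₁ φ) + T (restrictTo D Γ₂ φ) := by
  have hsplit : ∀ f : Plane → ℂ, Integrable f (arcLength D) → ∫ y, f y ∂arcLength D =
      (∫ y in Γ₁, f y ∂arcLength D) + ∫ y in Γ₂, f y ∂arcLength D := fun f hf => by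
    have hμ : (arcLength D).restrict (Γ₁ ∪ Γ₂) = arcLength D := by
      rw [hunion, arcLength, Measure.restrict_restrict isClosed_frontier.measurableSet, inter_self]
    rw [← setIntegral_union hdisj hm₂ hf.integrableOn hf.integrableOn, hμ]
  have hφ₁ : restrictTo D Γ₁ φ =ᵐ[(arcLength D).restrict Γ₁] φ := LpToLpRestrictCLM_coeFn ℂ Γ₁ φ
  have hφ₂ : restrictTo D Γ₂ φ =ᵐ[(arcLength D).restrict Γ₂] φ := LpToLpRestrictCLM_coeFn ℂ Γ₂ φ
  have hKφ : restrictTo D Γ₁ (Kk φ) =ᵐ[(arcLength D).restrict Γ₁] Kk φ :=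
    LpToLpRestrictCLM_coeFn ℂ Γ₁ (Kk φ)
  refine Lp.ext ?_
  filter_upwards [hKφ, ae_restrict_of_ae (hK φ), hK₁ (restrictTo D Γ₁ φ), hR (restrictTo D Γ₁ φ),
    hT (restrictTo D Γ₂ φ), Lp.coeFn_add (K₁ (restrictTo D Γ₁ φ) + R (restrictTo D Γ₁ φ))
      (T (restrictTo D Γ₂ φ)), Lp.coeFn_add (K₁ (restrictTo D Γ₁ φ)) (R (restrictTo D Γ₁ φ))]
    with x h1 h2 h3 h4 h5 h6 h7
  rw [h1, h2.2, h6, Pi.add_apply, h7, Pi.add_apply, h3.2, h4.2, h5.2, ← integral_add h3.1 h4.1,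
    hsplit _ h2.1]
  congr 1
  · refine integral_congr_ae ?_
    filter_upwards [hφ₁] with y hy
    rw [hy]; ring
  · refine integral_congr_ae ?_
    filter_upwards [hφ₂] with y hy
    rw [hy]

end NPOperator

theorem mainTheorem2 (n : ℕ∞) (hn : 1 ≤ n) (D : Set NPOperator.Plane)
    (hD : NPOperator.IsSmoothDomain (n + 1) D) (xR : NPOperator.Plane) (hxR : xR ∈ frontier D) :
    ∃ C ρ₀ ε : ℝ, 0 < C ∧ 0 < ρ₀ ∧ 0 < ε ∧
      ∀ ρ k : ℝ, 0 < ρ → ρ < ρ₀ → 0 < k →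
        ∃ (Kk : Lp ℂ 2 (NPOperator.arcLength D) →L[ℂ] Lp ℂ 2 (NPOperator.arcLength D))
          (K₁ R : NPOperator.L2 D (NPOperator.nearPart D xR ρ) →L[ℂ]
            NPOperator.L2 D (NPOperator.nearPart D xR ρ))
          (T : NPOperator.L2 D (NPOperator.farPart D xR ρ) →L[ℂ]
            NPOperator.L2 D (NPOperator.nearPart D xR ρ)),
          NPOperator.IsIntegralOperator (NPOperator.helmholtzKernel D k) Kk ∧
          NPOperator.IsIntegralOperator (NPOperator.laplaceKernel D) K₁ ∧
          (∀ φ : Lp ℂ 2 (NPOperator.arcLength D),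
            NPOperator.restrictTo D (NPOperator.nearPart D xR ρ) (Kk φ) =
              K₁ (NPOperator.restrictTo D (NPOperator.nearPart D xR ρ) φ) +
              R (NPOperator.restrictTo D (NPOperator.nearPart D xR ρ) φ) +
              T (NPOperator.restrictTo D (NPOperator.farPart D xR ρ) φ)) ∧
          NPOperator.IsSmoothing n T ∧
          (ρ * k < ε → ‖R‖ ≤ C * ((ρ * k) ^ 2 * |Real.log (ρ * k)|)) := by
  open NPOperator in
  have := hD.isFiniteMeasure_arcLength
  obtain ⟨C, hC, hdiff⟩ := exists_norm_helmholtz_sub_laplace_le (Real.exp (-1))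
  obtain ⟨ρ₀, hρ₀, harc⟩ := hD.exists_hausdorffMeasure_le hxR
  -- The `8` is the `2` of `mul_one_add_abs_log_le` times the `4` of the length bound; the added `1`
  -- keeps the constant positive when `C = 0`.
  refine ⟨8 * C + 1, ρ₀, Real.exp (-1), by positivity, hρ₀, Real.exp_pos _,
    fun ρ k hρ hρρ hk => ?_⟩
  have hm : MeasurableSet (nearPart D xR ρ) :=
    isClosed_frontier.measurableSet.inter Metric.isOpen_ball.measurableSet
  obtain ⟨M₀, hM₀, hb₀⟩ := hD.exists_norm_laplaceKernel_le hn
  obtain ⟨M, hM, hb⟩ := hD.exists_norm_helmholtz_sub_laplace_le hk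
  have hbk : ∀ x ∈ frontier D, ∀ y ∈ frontier D, x ≠ y → ‖helmholtzKernel D k x y‖ ≤ M + M₀ :=
    fun x hx y hy hxy => by
      have := norm_add_le (helmholtzKernel D k x y - laplaceKernel D x y) (laplaceKernel D x y)
      rw [sub_add_cancel] at this
      exact this.trans (add_le_add (hb x hx y hy hxy) (hb₀ x hx y hy))
  have hck := hD.continuousOn_helmholtzKernel hk
  have hc₀ := hD.continuousOn_laplaceKernel
  have hle : ∀ Γ, (arcLength D).restrict Γ ≤ arcLength D := fun Γ => Measure.restrict_le_self
  obtain ⟨Kk, hKk, -⟩ := hD.exists_isIntegralOperator hck le_rfl le_rfl (add_nonneg hM hM₀)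
    (ae_of_all _ fun x => ae_of_all _ fun y hx hy hxy => hbk x hx y hy hxy)
  obtain ⟨K₁, hK₁, -⟩ := hD.exists_isIntegralOperator hc₀ (hle (nearPart D xR ρ))
    (hle (nearPart D xR ρ)) hM₀
    (ae_of_all _ fun x => ae_of_all _ fun y hx hy _ => hb₀ x hx y hy)
  obtain ⟨T, hT, -⟩ := hD.exists_isIntegralOperator hck (hle (farPart D xR ρ))
    (hle (nearPart D xR ρ)) (add_nonneg hM hM₀)
    (ae_of_all _ fun x => ae_of_all _ fun y hx hy hxy => hbk x hx y hy hxy)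
  obtain ⟨R, hR, hRn⟩ : ∃ R : L2 D (nearPart D xR ρ) →L[ℂ] L2 D (nearPart D xR ρ),
      IsIntegralOperator (fun x y => helmholtzKernel D k x y - laplaceKernel D x y) R ∧
      (ρ * k < Real.exp (-1) → ‖R‖ ≤ (8 * C + 1) * ((ρ * k) ^ 2 * |Real.log (ρ * k)|)) := by
    -- The quantitative kernel bound is available only for small `ρk`; otherwise a bound depending
    -- on `k` still yields the operator.
    by_cases hsmall : ρ * k < Real.exp (-1)
    · have hmem : ∀ᵐ x ∂(arcLength D).restrict (nearPart D xR ρ), x ∈ nearPart D xR ρ :=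
        ae_restrict_mem hm
      obtain ⟨R, hR, hRn⟩ := hD.exists_isIntegralOperator
        (κ := fun x y => helmholtzKernel D k x y - laplaceKernel D x y) (hck.sub hc₀)
        (hle (nearPart D xR ρ)) (hle (nearPart D xR ρ)) (M := C * k * (2 * (ρ * k * |Real.log (ρ * k)|))) (by positivity) (by
          filter_upwards [hmem] with x hx
          filter_upwards [hmem] with y hy _ _ hxy
          have hz : 0 < ‖x - y‖ := norm_pos_iff.2 (sub_ne_zero.2 hxy)
          have ht : k * ‖x - y‖ / 2 ≤ ρ * k := by
            have h1 : dist x xR < ρ := hx.2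
            have h2 : dist y xR < ρ := hy.2
            have h3 := dist_triangle_right x y xR
            rw [dist_eq_norm x y] at h3
            nlinarith
          refine (hdiff D k x y hk hxy (ht.trans hsmall.le) (norm_outwardNormal_le D x)).trans ?_
          refine mul_le_mul_of_nonneg_left ?_ (by positivity)
          exact mul_one_add_abs_log_le (by positivity) ht hsmall.le)
      refine ⟨R, hR, fun _ => hRn.trans ?_⟩
      have hlen : ((arcLength D).restrict (nearPart D xR ρ)).real univ ≤ 4 * ρ := by
        refine ENNReal.toReal_le_of_le_ofReal (by positivity) ?_
        rw [Measure.restrict_apply_univ]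
        exact (Measure.restrict_apply_le _ _).trans (harc ρ hρ hρρ)
      rw [Real.mul_self_sqrt measureReal_nonneg]
      calc _ ≤ C * k * (2 * (ρ * k * |Real.log (ρ * k)|)) * (4 * ρ) := by gcongr
        _ = 8 * C * ((ρ * k) ^ 2 * |Real.log (ρ * k)|) := by ring
        _ ≤ _ := by gcongr; linarith
    · obtain ⟨R, hR, -⟩ := hD.exists_isIntegralOperator
        (κ := fun x y => helmholtzKernel D k x y - laplaceKernel D x y) (hck.sub hc₀)
        (hle (nearPart D xR ρ)) (hle (nearPart D xR ρ)) hM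
        (ae_of_all _ fun x => ae_of_all _ fun y hx hy hxy => hb x hx y hy hxy)
      exact ⟨R, hR, fun h => absurd h hsmall⟩
  exact ⟨Kk, K₁, R, T, hKk, hK₁, restrictTo_apply_eq
    (isClosed_frontier.measurableSet.diff hm) disjoint_sdiff_right
    (union_sdiff_cancel inter_subset_left) hKk hK₁ hR hT, hD.isSmoothing hk hT, hRn⟩
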